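/- Let $\mathcal X$ be a set and let $k:\mathcal X\times\mathcal X\to\mathbb R$ be a symmetric positive definite kernel (every matrix $[k(x_i,x_j)]_{i,j}$ is positive semidefinite) whose diagonal $x\mapsto k(x,x)$ is bounded, with $k(x,x)\ge 1$ for at least one $x\in\mathcal X$ (for instance, a kernel normalized by $k(x,x)=1$ for all $x$). Fix $\lambda>0$. For points $x_1,\dots,x_n\in\mathcal X$ write $$\sigma^2_{x_1,\dots,x_n}(x)=k(x,x)-k_n(x)^\top (K_n+\lambda I_n)^{-1}k_n(x),\qquad k_n(x)=(k(x_1,x),\dots,k(x_n,x))^\top,\quad K_n=[k(x_i,x_j)]_{i,j=1}^n,$$ for the Gaussian process posterior variance, and let the maximal information gain be $$\gamma_n=\sup_{(x_1,\dots,x_n)\in\mathcal X^n}\ \sum_{i=1}^n\sigma^2_{x_1,\dots,x_{i-1}}(x_i).$$ Let $K\ge 1$ be the number of clients, $T\ge 1$ the time horizon, and $N_T\le T$ the length of the exploration phase, in which client $i$ queries points $x_{i,1},\dots,x_{i,N_T}\in\mathcal X$ (arbitrary fixed points; in particular, points chosen successively to maximize the posterior variance). Write $\sigma^2_{i,N_T}=\sigma^2_{x_{i,1},\dots,x_{i,N_T}}$.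 Each client $i$ forms its set of inducing points by including each $x_{i,j}$, $1\le j\le N_T$, with probability $\min\{1,\,q_0\,\sigma^2_{i,N_T}(x_{i,j})\}$, independently over $j$ (nothing is assumed about the joint law across different clients). Let $M_i$ be the number of points that client $i$ includes, repeated points being counted with multiplicity. Let $\delta,\varepsilon\in(0,1)$, $\chi=\frac{1+\varepsilon}{1-\varepsilon}$, and $q_0\ge 6\chi\log(4TK/\delta)/\varepsilon^2$. Then, with probability at least $1-\delta$, $$\max_{1\le i\le K} M_i\ \le\ 9\Bigl(1+\frac1\lambda\Bigr)\,q_0\,\gamma_{N_T}.$$ -/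

import Mathlib

open MeasureTheory ProbabilityTheory

noncomputable section

namespace KernelBandit

/-- The kernel (Gram) matrix `[k(x_i, x_j)]_{i,j}` of a tuple of points. -/
def gram {X : Type*} (k : X → X → ℝ) {n : ℕ} (x : Fin n → X) : Matrix (Fin n) (Fin n) ℝ :=
  Matrix.of fun i j => k (x i) (x j)

/-- A positive definite kernel in the sense of RKHS theory: all finite kernel matrices are
symmetric and positive semidefinite. -/
def IsPosDefKernel {X : Type*} (k : X → X → ℝ) : Prop :=
  ∀ (n : ℕ) (x : Fin n → X), (gram k x).PosSemidef

/-- Posterior covariance of the centered GP with covariance `k`, after observations at the points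
`x` with Gaussian noise of variance `lam`:
`k(y, y') - k_{x,y}ᵀ (K_{x,x} + lam I)⁻¹ k_{x,y'}`. -/
def postCov {X : Type*} (k : X → X → ℝ) (lam : ℝ) {n : ℕ} (x : Fin n → X) (y y' : X) : ℝ :=
  k y y' - (fun i => k (x i) y) ⬝ᵥ
    ((gram k x + lam • (1 : Matrix (Fin n) (Fin n) ℝ))⁻¹.mulVec fun i => k (x i) y')

/-- Posterior variance `σ²(y)` given the query points `x`. -/
def postVar {X : Type*} (k : X → X → ℝ) (lam : ℝ) {n : ℕ} (x : Fin n → X) (y : X) : ℝ :=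
  postCov k lam x y y

/-- `∑_{i=1}^n σ²_{i-1}(x_i)`, where `σ²_{i-1}` is the posterior variance given the points of the
tuple that come before `x_i`. -/
def infoGain {X : Type*} (k : X → X → ℝ) (lam : ℝ) {n : ℕ} (x : Fin n → X) : ℝ :=
  ∑ i : Fin n, postVar k lam (fun l : Fin i => x (Fin.castLE i.isLt.le l)) (x i)

/-- The maximal information gain `γ_n`: the supremum of `∑_{i=1}^n σ²_{i-1}(x_i)` over `X^n`. -/
def maxInfoGain {X : Type*} (k : X → X → ℝ) (lam : ℝ) (n : ℕ) : ℝ :=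
  ⨆ x : Fin n → X, infoGain k lam x

/-- The inclusion probability of the `j`-th query point, `q₀ σ²_N(x_j)`, truncated at `1`. -/
def inclusionProb {X : Type*} (k : X → X → ℝ) (lam q₀ : ℝ) {N : ℕ} (x : Fin N → X)
    (j : Fin N) : ℝ :=
  min 1 (q₀ * postVar k lam x (x j))

open Classical in
/-- The number of selected points at outcome `ω`, where `S j` is the event that the `j`-th
query point is selected; repeated points count with multiplicity. -/
def inducingSize {Ω : Type*} {N : ℕ} (S : Fin N → Set Ω) (ω : Ω) : ℕ :=
  (Finset.univ.filter fun j => ω ∈ S j).card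

end KernelBandit

end

namespace KernelBandit

open Matrix

/-! The posterior variance is the minimum of a ridge-regularized quadratic loss, so dropping
observations can only increase it. Hence `∑ j, σ²_N(x_j)` is at most the sequential sum defining the
information gain, and each client's expected count is at most `A = q₀ γ_N`. A Chernoff bound gives
`P(M_i ≥ 9A) ≤ exp(-7A)`. The lower bound on `q₀`, with `γ_N ≥ 1` from the diagonal condition, makes
this at most `δ / K`; a union bound, which needs no independence across clients, concludes. -/

/-- The regularized squared loss of the linear predictor with weights `a` at the point `y`, whose
minimum over `a` is the posterior variance. -/
def regLoss {X : Type*} (k : X → X → ℝ) (lam : ℝ) {n : ℕ} (x : Fin n → X) (y : X)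
    (a : Fin n → ℝ) : ℝ :=
  k y y - 2 * (a ⬝ᵥ fun i => k (x i) y) + a ⬝ᵥ (gram k x *ᵥ a) + lam * (a ⬝ᵥ a)

section Variance

variable {X : Type*} {k : X → X → ℝ} {lam : ℝ}

lemma IsPosDefKernel.symm (hk : IsPosDefKernel k) (y z : X) : k y z = k z y := by
  have h := (hk 2 ![y, z]).1.apply 1 0
  simpa [gram] using h

/-- Apart from the ridge term, the loss is the quadratic form of the Gram matrix of `(y, x)` at `(1,
-a)`. -/
lemma IsPosDefKernel.regLoss_nonneg (hk : IsPosDefKernel k) (hlam : 0 ≤ lam) {n : ℕ}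
    (x : Fin n → X) (y : X) (a : Fin n → ℝ) : 0 ≤ regLoss k lam x y a := by
  have h := (hk (n + 1) (Fin.cons y x)).dotProduct_mulVec_nonneg (Fin.cons 1 (-a))
  have h2 : 0 ≤ lam * (a ⬝ᵥ a) := mul_nonneg hlam (by
    simpa using dotProduct_star_self_nonneg a)
  have h3 : star (Fin.cons 1 (-a) : Fin (n + 1) → ℝ) ⬝ᵥ
      (gram k (Fin.cons y x : Fin (n + 1) → X) *ᵥ (Fin.cons 1 (-a))) =
      k y y - 2 * (a ⬝ᵥ fun i => k (x i) y) + a ⬝ᵥ (gram k x *ᵥ a) := by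
    simp only [dotProduct, mulVec, gram, Matrix.of_apply, Fin.sum_univ_succ, Fin.cons_zero,
      Fin.cons_succ, Pi.star_apply, star_trivial, Pi.neg_apply, mul_neg, neg_mul, mul_one, one_mul,
      mul_add, Finset.sum_neg_distrib, Finset.sum_add_distrib, hk.symm y, mul_comm (a _) (k _ y)]
    ring
  rw [h3] at h
  exact add_nonneg h h2

lemma IsPosDefKernel.posDef_gram_add (hk : IsPosDefKernel k) (hlam : 0 < lam) {n : ℕ}
    (x : Fin n → X) : (gram k x + lam • (1 : Matrix (Fin n) (Fin n) ℝ)).PosDef :=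
  PosDef.posSemidef_add (hk n x) (PosDef.one.smul hlam)

lemma regLoss_eq {n : ℕ} (x : Fin n → X) (y : X) (a : Fin n → ℝ) :
    regLoss k lam x y a = k y y - 2 * (a ⬝ᵥ fun i => k (x i) y) +
      a ⬝ᵥ ((gram k x + lam • (1 : Matrix (Fin n) (Fin n) ℝ)) *ᵥ a) := by
  simp only [regLoss, add_mulVec, smul_mulVec, one_mulVec, dotProduct_add, dotProduct_smul,
    smul_eq_mul]
  ring

/-- Completing the square around the minimizer. -/
lemma IsPosDefKernel.regLoss_eq_postVar_add (hk : IsPosDefKernel k) (hlam : 0 < lam) {n : ℕ}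
    (x : Fin n → X) (y : X) (d : Fin n → ℝ) :
    regLoss k lam x y ((gram k x + lam • (1 : Matrix (Fin n) (Fin n) ℝ))⁻¹ *ᵥ
      (fun i => k (x i) y) + d) =
      postVar k lam x y + d ⬝ᵥ ((gram k x + lam • (1 : Matrix (Fin n) (Fin n) ℝ)) *ᵥ d) := by
  have hA := hk.posDef_gram_add hlam x
  rw [regLoss_eq, postVar, postCov]
  set A := gram k x + lam • (1 : Matrix (Fin n) (Fin n) ℝ)
  set b : Fin n → ℝ := fun i => k (x i) y
  set c := A⁻¹ *ᵥ b with hc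
  have hAc : A *ᵥ c = b := by
    rw [hc, mulVec_mulVec, mul_nonsing_inv _ ((isUnit_iff_isUnit_det A).mp hA.isUnit), one_mulVec]
  have hsymm : c ⬝ᵥ (A *ᵥ d) = d ⬝ᵥ b := by
    have hT : Aᵀ = A := by simpa using hA.isHermitian.eq
    rw [dotProduct_mulVec, ← mulVec_transpose, hT, hAc, dotProduct_comm]
  rw [mulVec_add, hAc, add_dotProduct, add_dotProduct, dotProduct_add, dotProduct_add, hsymm,
    dotProduct_comm b c]
  ring

lemma IsPosDefKernel.postVar_le_regLoss (hk : IsPosDefKernel k) (hlam : 0 < lam) {n : ℕ}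
    (x : Fin n → X) (y : X) (a : Fin n → ℝ) : postVar k lam x y ≤ regLoss k lam x y a := by
  have h := hk.regLoss_eq_postVar_add hlam x y
    (a - (gram k x + lam • (1 : Matrix (Fin n) (Fin n) ℝ))⁻¹ *ᵥ (fun i => k (x i) y))
  rw [add_sub_cancel] at h
  rw [h]
  exact le_add_of_nonneg_right (by
    simpa using (hk.posDef_gram_add hlam x).posSemidef.dotProduct_mulVec_nonneg
      (a - (gram k x + lam • (1 : Matrix (Fin n) (Fin n) ℝ))⁻¹ *ᵥ (fun i => k (x i) y)))

lemma IsPosDefKernel.exists_regLoss_eq_postVar (hk : IsPosDefKernel k) (hlam : 0 < lam) {n : ℕ}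
    (x : Fin n → X) (y : X) : ∃ a, regLoss k lam x y a = postVar k lam x y :=
  ⟨_, (hk.regLoss_eq_postVar_add hlam x y 0).trans (by simp)⟩

lemma IsPosDefKernel.postVar_nonneg (hk : IsPosDefKernel k) (hlam : 0 < lam) {n : ℕ}
    (x : Fin n → X) (y : X) : 0 ≤ postVar k lam x y := by
  obtain ⟨a, ha⟩ := hk.exists_regLoss_eq_postVar hlam x y
  exact ha ▸ hk.regLoss_nonneg hlam.le x y a

lemma IsPosDefKernel.postVar_le (hk : IsPosDefKernel k) (hlam : 0 < lam) {n : ℕ}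
    (x : Fin n → X) (y : X) : postVar k lam x y ≤ k y y := by
  simpa [regLoss] using hk.postVar_le_regLoss hlam x y 0

/-- Conditioning on more points does not increase the posterior variance. -/
lemma IsPosDefKernel.postVar_le_postVar_comp (hk : IsPosDefKernel k) (hlam : 0 < lam) {m n : ℕ}
    (x : Fin n → X) {e : Fin m → Fin n} (he : Function.Injective e) (y : X) :
    postVar k lam x y ≤ postVar k lam (x ∘ e) y := by
  obtain ⟨a, ha⟩ := hk.exists_regLoss_eq_postVar hlam (x ∘ e) y
  have hsum (g : Fin n → ℝ) : Function.extend e a 0 ⬝ᵥ g = a ⬝ᵥ (g ∘ e) := by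
    refine (Fintype.sum_of_injective e he _ _ (fun i hi => ?_) fun i => ?_).symm
    · rw [Function.extend_apply' _ _ _ (by simpa using hi)]
      simp
    · simp [he.extend_apply]
  have hmul : (gram k x *ᵥ Function.extend e a 0) ∘ e = gram k (x ∘ e) *ᵥ a := by
    ext i
    simp only [Function.comp_apply, mulVec]
    rw [dotProduct_comm, hsum, dotProduct_comm]
    rfl
  -- Padding the optimal weights of the subtuple with zeros leaves the loss unchanged.
  refine (hk.postVar_le_regLoss hlam x y (Function.extend e a 0)).trans_eq ?_
  rw [← ha]
  simp only [regLoss, hsum, hmul, Function.extend_comp he]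
  rfl

lemma IsPosDefKernel.sum_postVar_le_infoGain (hk : IsPosDefKernel k) (hlam : 0 < lam) {n : ℕ}
    (x : Fin n → X) : ∑ j, postVar k lam x (x j) ≤ infoGain k lam x :=
  Finset.sum_le_sum fun i _ =>
    hk.postVar_le_postVar_comp hlam x (Fin.castLE_injective i.isLt.le) (x i)

lemma IsPosDefKernel.bddAbove_range_infoGain (hk : IsPosDefKernel k) (hlam : 0 < lam)
    (hb : BddAbove (Set.range fun y : X => k y y)) (n : ℕ) :
    BddAbove (Set.range fun x : Fin n → X => infoGain k lam x) := by
  obtain ⟨B, hB⟩ := hb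
  refine ⟨∑ _i : Fin n, B, ?_⟩
  rintro _ ⟨x, rfl⟩
  exact Finset.sum_le_sum fun i _ =>
    (hk.postVar_le hlam _ (x i)).trans (hB (Set.mem_range_self (x i)))

/-- In the constant tuple `y`, the first term conditions on nothing and equals `k y y`; the others
are nonnegative. -/
lemma IsPosDefKernel.le_maxInfoGain (hk : IsPosDefKernel k) (hlam : 0 < lam)
    (hb : BddAbove (Set.range fun y : X => k y y)) {n : ℕ} (hn : 0 < n) (y : X) :
    k y y ≤ maxInfoGain k lam n := by
  refine le_trans ?_ (le_ciSup (hk.bddAbove_range_infoGain hlam hb n) fun _ => y)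
  refine le_trans ?_ (Finset.single_le_sum (fun i _ => hk.postVar_nonneg hlam _ y)
    (Finset.mem_univ (⟨0, hn⟩ : Fin n)))
  simp [postVar, postCov, dotProduct]

end Variance

section Concentration

lemma inducingSize_eq_sum_indicator {Ω : Type*} {N : ℕ} (S : Fin N → Set Ω) :
    (fun ω => (inducingSize S ω : ℝ)) = ∑ j, (S j).indicator fun _ => (1 : ℝ) := by
  classical
  ext ω
  simp [inducingSize, Set.indicator_apply]

lemma inducingSize_le {Ω : Type*} {N : ℕ} (S : Fin N → Set Ω) (ω : Ω) :
    inducingSize S ω ≤ N := by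
  classical
  exact (Finset.card_filter_le _ _).trans_eq (by simp)

variable {Ω : Type*} [MeasurableSpace Ω] {P : Measure Ω} [IsProbabilityMeasure P]

lemma measurable_inducingSize {N : ℕ} {S : Fin N → Set Ω} (hS : ∀ j, MeasurableSet (S j)) :
    Measurable fun ω => (inducingSize S ω : ℝ) := by
  rw [inducingSize_eq_sum_indicator, Finset.sum_fn]
  exact Finset.measurable_sum _ fun j _ => measurable_const.indicator (hS j)

lemma mgf_indicator_one {s : Set Ω} (hs : MeasurableSet s) :
    mgf (s.indicator fun _ => (1 : ℝ)) P 1 = 1 + (Real.exp 1 - 1) * P.real s := by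
  have h : (fun ω => Real.exp (1 * s.indicator (fun _ => (1 : ℝ)) ω)) =
      fun ω => 1 + s.indicator (fun _ => Real.exp 1 - 1) ω := by
    ext ω
    by_cases hω : ω ∈ s <;> simp [hω]
  rw [mgf, h, integral_add (integrable_const _) ((integrable_const _).indicator hs),
    integral_indicator_const _ hs]
  simp [mul_comm]

/-- Chernoff bound for a sum of independent indicators with total probability at most `A`. -/
lemma measureReal_inducingSize_ge_le {N : ℕ} {S : Fin N → Set Ω}
    (hS : ∀ j, MeasurableSet (S j)) (hind : iIndepSet S P) {A : ℝ}
    (hA : ∑ j, P.real (S j) ≤ A) :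
    P.real {ω | 9 * A ≤ inducingSize S ω} ≤ Real.exp (-(7 * A)) := by
  have hA0 : 0 ≤ A := (Finset.sum_nonneg fun j _ => measureReal_nonneg).trans hA
  have he : Real.exp 1 ≤ 3 := Real.exp_one_lt_d9.le.trans (by norm_num)
  have hm (j : Fin N) : Measurable ((S j).indicator fun _ => (1 : ℝ)) :=
    measurable_const.indicator (hS j)
  have hint : Integrable (fun ω => Real.exp (1 * (inducingSize S ω : ℝ))) P :=
    integrable_exp_mul_of_mem_Icc (a := 0) (b := N) (measurable_inducingSize hS).aemeasurable
      (ae_of_all _ fun ω => ⟨Nat.cast_nonneg _, Nat.cast_le.2 (inducingSize_le S ω)⟩)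
  -- Each factor is `1 + (e - 1) p ≤ exp (2 p)`, since `e ≤ 3`.
  have hmgf : mgf (fun ω => (inducingSize S ω : ℝ)) P 1 ≤ Real.exp (2 * A) := by
    rw [inducingSize_eq_sum_indicator, hind.iIndepFun_indicator.mgf_sum hm]
    calc ∏ j, mgf ((S j).indicator fun _ => (1 : ℝ)) P 1
        ≤ ∏ j, Real.exp (2 * P.real (S j)) := by
          refine Finset.prod_le_prod (fun _ _ => mgf_nonneg) fun j _ => ?_
          rw [mgf_indicator_one (hS j)]
          have := Real.add_one_le_exp (2 * P.real (S j))
          nlinarith [measureReal_nonneg (μ := P) (s := S j)]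
      _ = Real.exp (2 * ∑ j, P.real (S j)) := by rw [← Real.exp_sum, Finset.mul_sum]
      _ ≤ Real.exp (2 * A) := by gcongr
  calc P.real {ω | 9 * A ≤ inducingSize S ω}
      ≤ Real.exp (-1 * (9 * A)) * mgf (fun ω => (inducingSize S ω : ℝ)) P 1 :=
        measure_ge_le_exp_mul_mgf _ zero_le_one hint
    _ ≤ Real.exp (-1 * (9 * A)) * Real.exp (2 * A) := by gcongr
    _ = Real.exp (-(7 * A)) := by rw [← Real.exp_add]; ring_nf

end Concentration

end KernelBandit

theorem mainTheorem5 {X : Type*} (k : X → X → ℝ) (hk : KernelBandit.IsPosDefKernel k)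
    (hk_bdd : BddAbove (Set.range fun y : X => k y y))
    (hk_norm : ∃ y : X, 1 ≤ k y y)
    (lam : ℝ) (hlam : 0 < lam)
    (K T N : ℕ) (hK : 1 ≤ K) (hT : 1 ≤ T) (hN : N ≤ T)
    (x : Fin K → Fin N → X)
    (δ : ℝ) (hδ : δ ∈ Set.Ioo (0 : ℝ) 1) (ε : ℝ) (hε : ε ∈ Set.Ioo (0 : ℝ) 1)
    (χ : ℝ) (hχ : χ = (1 + ε) / (1 - ε))
    (q₀ : ℝ) (hq₀ : 6 * χ * Real.log (4 * (T : ℝ) * (K : ℝ) / δ) / ε ^ 2 ≤ q₀)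
    {Ω : Type*} [MeasurableSpace Ω] (P : Measure Ω) [IsProbabilityMeasure P]
    (S : Fin K → Fin N → Set Ω) (hS_meas : ∀ i j, MeasurableSet (S i j))
    (hS_indep : ∀ i, iIndepSet (S i) P)
    (hS_prob : ∀ i j, P.real (S i j) = KernelBandit.inclusionProb k lam q₀ (x i) j) :
    1 - δ ≤ P.real {ω | ((Finset.univ.sup fun i => KernelBandit.inducingSize (S i) ω : ℕ) : ℝ)
      ≤ 9 * (1 + 1 / lam) * q₀ * KernelBandit.maxInfoGain k lam N} := by
  obtain ⟨y, hy⟩ := hk_norm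
  obtain ⟨hδ0, hδ1⟩ := hδ
  obtain ⟨hε0, hε1⟩ := hε
  rcases Nat.eq_zero_or_pos N with rfl | hNpos
  -- Treated apart because `γ_0 = 0`, so `1 ≤ γ_N` fails; both sides of the bound vanish.
  · simp [KernelBandit.inducingSize, KernelBandit.maxInfoGain, KernelBandit.infoGain, hδ0.le]
  have hK' : (1 : ℝ) ≤ K := by exact_mod_cast hK
  have hT' : (1 : ℝ) ≤ T := by exact_mod_cast hT
  have hKδ : (K : ℝ) / δ ≤ 4 * T * K / δ := by
    gcongr
    nlinarith
  have hKδ1 : 1 ≤ (K : ℝ) / δ := (one_le_div hδ0).2 (hδ1.le.trans hK')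
  set L := Real.log (4 * (T : ℝ) * (K : ℝ) / δ) with hL
  have hL0 : 0 ≤ L := Real.log_nonneg (hKδ1.trans hKδ)
  have hχ1 : 1 ≤ χ := by
    rw [hχ, one_le_div (by linarith)]
    linarith
  have hLq : L ≤ q₀ := by
    refine le_trans ?_ hq₀
    rw [le_div_iff₀ (by positivity)]
    calc L * ε ^ 2 ≤ L * 1 := by gcongr; exact pow_le_one₀ hε0.le hε1.le
      _ ≤ 6 * χ * L := by nlinarith
  have hq0 : 0 ≤ q₀ := hL0.trans hLq
  have hγ1 : 1 ≤ KernelBandit.maxInfoGain k lam N := hy.trans (hk.le_maxInfoGain hlam hk_bdd hNpos y)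
  set A := q₀ * KernelBandit.maxInfoGain k lam N with hA
  have hLA : L ≤ A := hLq.trans (le_mul_of_one_le_right hq0 hγ1)
  have hA0 : 0 ≤ A := hL0.trans hLA
  -- The factor `1 + 1 / lam` is pure slack.
  have hthr : 9 * A ≤ 9 * (1 + 1 / lam) * q₀ * KernelBandit.maxInfoGain k lam N := by
    have : 0 ≤ 1 / lam * A := by positivity
    rw [hA] at this ⊢
    linarith
  have hmean (i : Fin K) : ∑ j, P.real (S i j) ≤ A := by
    calc ∑ j, P.real (S i j) ≤ ∑ j, q₀ * KernelBandit.postVar k lam (x i) (x i j) :=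
          Finset.sum_le_sum fun j _ => (hS_prob i j).trans_le (min_le_right _ _)
      _ = q₀ * ∑ j, KernelBandit.postVar k lam (x i) (x i j) := by rw [Finset.mul_sum]
      _ ≤ A := by
          rw [hA]
          gcongr
          exact (hk.sum_postVar_le_infoGain hlam (x i)).trans
            (le_ciSup (hk.bddAbove_range_infoGain hlam hk_bdd N) (x i))
  have htail (i : Fin K) : P.real {ω | 9 * A ≤ KernelBandit.inducingSize (S i) ω} ≤ δ / K := by
    refine (KernelBandit.measureReal_inducingSize_ge_le (hS_meas i) (hS_indep i) (hmean i)).trans ?_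
    calc Real.exp (-(7 * A)) ≤ Real.exp (-L) := Real.exp_le_exp.2 (by linarith)
      _ = (4 * T * K / δ)⁻¹ := by rw [Real.exp_neg, hL, Real.exp_log (by positivity)]
      _ ≤ (K / δ)⁻¹ := by gcongr
      _ = δ / K := inv_div _ _
  have hbad : P.real (⋃ i, {ω | 9 * A ≤ (KernelBandit.inducingSize (S i) ω : ℝ)}) ≤ δ := by
    refine (measureReal_iUnion_fintype_le _).trans ?_
    refine (Finset.sum_le_sum fun i _ => htail i).trans_eq ?_
    simp only [Finset.sum_const, Finset.card_univ, Fintype.card_fin, nsmul_eq_mul]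
    field_simp
  have hmeas (i : Fin K) :
      MeasurableSet {ω | 9 * A ≤ (KernelBandit.inducingSize (S i) ω : ℝ)} :=
    measurableSet_le measurable_const (KernelBandit.measurable_inducingSize (hS_meas i))
  calc 1 - δ ≤ P.real (⋃ i, {ω | 9 * A ≤ (KernelBandit.inducingSize (S i) ω : ℝ)})ᶜ := by
        rw [probReal_compl_eq_one_sub (MeasurableSet.iUnion hmeas)]
        linarith
    _ ≤ _ := by
        refine measureReal_mono fun ω hω => le_trans ?_ hthr
        simp only [Set.mem_compl_iff, Set.mem_iUnion, Set.mem_ofPred_eq, not_exists, not_le] at hω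
        -- The supremum is taken in `ℕ`, so the real threshold is replaced by its floor.
        rw [← Nat.le_floor_iff (by positivity), Finset.sup_le_iff]
        exact fun i _ => Nat.le_floor (hω i).le
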